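/- A topological space $X$ is called a $\Delta$-space if for every decreasing sequence $(D_n)_{n\in\omega}$ of subsets of $X$ with $\bigcap_n D_n=\emptyset$ there is a decreasing sequence $(V_n)_{n\in\omega}$ of open subsets of $X$ with $\bigcap_n V_n=\emptyset$ and $D_n\subseteq V_n$ for every $n\in\omega$. For a Tychonoff space $X$, let $C_p(X)$ denote the real vector space of all continuous functions $X\to\mathbb{R}$ with the topology of pointwise convergence. A base of neighbourhoods of zero is a family of (not necessarily open) neighbourhoods of zero such that every neighbourhood of zero contains a member of the family. **Theorem.** Let $X$ and $Y$ be Tychonoff spaces, let $X$ be a $\Delta$-space, and let $T\colon C_p(X)\to C_p(Y)$ be a continuous linear surjection. Consider the following conditions. 1. $C_p(X)$ admits a base $\mathcal{U}$ of absolutely convex neighbourhoods of zero such that $\overline{T(U)}\subseteq 2\,T(U)$ for each $U\in\mathcal{U}$, where the closure is taken in $C_p(Y)$. 2. $T$ is an open mapping. 3. $C_p(X)$ admits a base $\mathcal{U}$ of absolutely convex closed neighbourhoods of zero such that $T(U)$ is closed in $C_p(Y)$ for each $U\in\mathcal{U}$. Then $(3)\Rightarrow(2)\Leftrightarrow(1)$.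 -/

import Mathlib

open Set Topology
open scoped Pointwise

/-- A topological space is a Δ-space if every decreasing sequence of (arbitrary) subsets with empty
intersection is dominated termwise by a decreasing sequence of open subsets with empty
intersection. -/
def IsDeltaSpace (X : Type*) [TopologicalSpace X] : Prop :=
  ∀ D : ℕ → Set X, Antitone D → ⋂ n, D n = ∅ →
    ∃ V : ℕ → Set X, Antitone V ∧ (∀ n, IsOpen (V n)) ∧ ⋂ n, V n = ∅ ∧ ∀ n, D n ⊆ V n

/-- `Cp X` is the real vector space of continuous functions `X → ℝ`. As a subspace of the product
`X → ℝ`, the type `↥(Cp X)` carries the topology of pointwise convergence. -/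
def Cp (X : Type*) [TopologicalSpace X] : Submodule ℝ (X → ℝ) where
  carrier := {f | Continuous f}
  add_mem' := fun hf hg => Continuous.add hf hg
  zero_mem' := continuous_const
  smul_mem' := fun c _ hf => Continuous.const_smul hf c

/-- `𝒰` is a base of absolutely convex neighbourhoods of zero of the real topological vector
space `E`: its members are absolutely convex neighbourhoods of zero (not required to be open), and
every neighbourhood of zero contains one of them. -/
def IsAbsConvexNhdsBase {E : Type*} [AddCommGroup E] [Module ℝ E] [TopologicalSpace E]
    (𝒰 : Set (Set E)) : Prop :=
  (∀ U ∈ 𝒰, AbsConvex ℝ U ∧ U ∈ 𝓝 (0 : E)) ∧ ∀ N ∈ 𝓝 (0 : E), ∃ U ∈ 𝒰, U ⊆ N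

/-!
The topology of `Cp X` is a weak topology: a neighbourhood of zero constrains a function at finitely
many points only, so it contains a subspace of finite codimension
(`Cp.exists_coFG_subset_of_mem_nhds_zero`).

This makes every continuous linear surjection `T` out of `Cp X` nearly open: `closure (T '' U)` is a
neighbourhood of zero for each absolutely convex neighbourhood `U` of zero
(`closure_image_mem_nhds_zero`). Indeed, let `K ⊆ U` be a subspace of finite codimension and `M` the
closure of `T(K)`. The composite of `T` with the quotient map by `M` is a linear surjection onto a
finite-dimensional Hausdorff space, hence an open map, so `T(U) + M` is a neighbourhood of zero. It
is contained in the double of `closure (T '' U)`, since `M ⊆ closure (T '' U)` and the latter is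
convex.

Openness of `T` follows as soon as each `closure (T '' U)` is absorbed by `T '' U`, in particular
when `T '' U` is closed. Conversely, if `T` is open then the set `T '' U` is a neighbourhood of zero,
so that `closure (T '' U) ⊆ T '' U + T '' U = 2 • T '' U` for every absolutely convex neighbourhood
`U` of zero.
-/

section NearlyOpen

variable {E F : Type*} [AddCommGroup E] [Module ℝ E] [TopologicalSpace E]
  [AddCommGroup F] [Module ℝ F] [TopologicalSpace F] [IsTopologicalAddGroup F]

/-- A continuous linear surjection is nearly open at each convex neighbourhood of zero that contains
a subspace of finite codimension. -/
theorem closure_image_mem_nhds_zero [IsTopologicalAddGroup E] [ContinuousSMul ℝ E]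
    [ContinuousSMul ℝ F] (T : E →L[ℝ] F) (hT : Function.Surjective T)
    {U : Set E} (hconv : Convex ℝ U) (hU : U ∈ 𝓝 (0 : E))
    (K : Submodule ℝ E) [FiniteDimensional ℝ (E ⧸ K)] (hKU : (K : Set E) ⊆ U) :
    closure (T '' U) ∈ 𝓝 (0 : F) := by
  set M : Submodule ℝ F := (K.map T.toLinearMap).topologicalClosure with hM
  have hMclosed : IsClosed (M : Set F) := Submodule.isClosed_topologicalClosure _
  have hMU : (M : Set F) ⊆ closure (T '' U) := by
    rw [hM, Submodule.topologicalClosure_coe, Submodule.map_coe]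
    exact closure_mono (image_mono hKU)
  let q : E →ₗ[ℝ] F ⧸ M := M.mkQ ∘ₗ T.toLinearMap
  have hq : Function.Surjective q := M.mkQ_surjective.comp hT
  have hKq : K ≤ LinearMap.ker q := fun x hx => by
    rw [LinearMap.mem_ker]
    exact (Submodule.Quotient.mk_eq_zero M).2
      (Submodule.le_topologicalClosure _ (Submodule.mem_map_of_mem hx))
  have : FiniteDimensional ℝ (F ⧸ M) := by
    refine Module.Finite.of_surjective (K.liftQ q hKq) ?_
    rw [← LinearMap.range_eq_top, Submodule.range_liftQ, LinearMap.range_eq_top]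
    exact hq
  have hnhds : q '' U ∈ 𝓝 (0 : F ⧸ M) := by
    have := (LinearMap.isOpenMap_of_finiteDimensional q hq).image_mem_nhds hU
    rwa [map_zero] at this
  have hpre : M.mkQ ⁻¹' (q '' U) ∈ 𝓝 (0 : F) := by
    have hc : Continuous M.mkQ := M.mkQL.continuous
    refine hc.continuousAt.preimage_mem_nhds ?_
    rwa [map_zero]
  have hhalf : Filter.Tendsto (fun y : F => (2 : ℝ) • y) (𝓝 0) (𝓝 0) := by
    have : Continuous fun y : F => (2 : ℝ) • y := continuous_const_smul _
    simpa using this.tendsto 0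
  filter_upwards [hhalf hpre] with y hy
  obtain ⟨u, hu, huy⟩ := hy
  have hmem : (2 : ℝ) • y - T u ∈ M := (Submodule.Quotient.eq M).1 huy.symm
  -- `y` is the midpoint of `T u` and an element of `M`.
  have hmid : (1 / 2 : ℝ) • T u + (1 / 2 : ℝ) • ((2 : ℝ) • y - T u) ∈ closure (T '' U) :=
    (hconv.linear_image T.toLinearMap).closure (subset_closure (mem_image_of_mem T hu))
      (hMU hmem) (by norm_num) (by norm_num) (by norm_num)
  have hy : (1 / 2 : ℝ) • T u + (1 / 2 : ℝ) • ((2 : ℝ) • y - T u) = y := by module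
  rwa [hy] at hmid

theorem isOpenMap_of_forall_exists_image_mem_nhds_zero [IsTopologicalAddGroup E] (T : E →L[ℝ] F)
    (h : ∀ N ∈ 𝓝 (0 : E), ∃ U ⊆ N, T '' U ∈ 𝓝 (0 : F)) : IsOpenMap T := by
  refine (IsTopologicalAddGroup.isOpenMap_iff_nhds_zero (f := T)).2 ?_
  intro S hS
  obtain ⟨U, hUS, hU⟩ := h _ hS
  exact Filter.mem_of_superset hU (image_subset_iff.2 hUS)

/-- Each point `y` of the closure is the sum of a point `z` of `s` near `y` and of `y - z`, which lies
in `s` because `s` is a neighbourhood of zero. -/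
theorem Convex.closure_subset_two_smul {s : Set F} (hs : Convex ℝ s) (h0 : s ∈ 𝓝 (0 : F)) :
    closure s ⊆ (2 : ℝ) • s := by
  intro y hy
  have hnear : ∀ᶠ z in 𝓝 y, y - z ∈ s := by
    have : Continuous fun z : F => y - z := by fun_prop
    exact this.continuousAt.eventually_mem (by simpa using h0)
  obtain ⟨z, hz, hzs⟩ := (mem_closure_iff_frequently.1 hy).and_eventually hnear |>.exists
  have h2 : (2 : ℝ) • s = s + s := by
    simpa [one_add_one_eq_two] using hs.add_smul (zero_le_one' ℝ) (zero_le_one' ℝ)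
  rw [h2]
  exact ⟨z, hz, y - z, hzs, add_sub_cancel z y⟩

end NearlyOpen

theorem Cp.exists_coFG_subset_of_mem_nhds_zero {X : Type*} [TopologicalSpace X] {U : Set (Cp X)}
    (hU : U ∈ 𝓝 (0 : Cp X)) :
    ∃ K : Submodule ℝ (Cp X), FiniteDimensional ℝ (Cp X ⧸ K) ∧ (K : Set (Cp X)) ⊆ U := by
  obtain ⟨V, hV, hVU⟩ := mem_nhds_induced _ _ _ |>.1 hU
  rw [nhds_pi, Filter.mem_pi] at hV
  obtain ⟨I, hI, t, ht, htV⟩ := hV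
  have := hI.to_subtype
  let r : Cp X →ₗ[ℝ] (I → ℝ) := LinearMap.funLeft ℝ ℝ ((↑) : I → X) ∘ₗ (Cp X).subtype
  refine ⟨LinearMap.ker r, Module.Finite.equiv r.quotKerEquivRange.symm, fun f hf => ?_⟩
  refine hVU (htV fun x hx => ?_)
  have hfx : (f : X → ℝ) x = 0 := congrFun (LinearMap.mem_ker.1 hf) ⟨x, hx⟩
  rw [hfx]
  exact mem_of_mem_nhds (ht x)

theorem isAbsConvexNhdsBase_setOf {E : Type*} [AddCommGroup E] [Module ℝ E] [TopologicalSpace E]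
    [IsTopologicalAddGroup E] [ContinuousSMul ℝ E] [LocallyConvexSpace ℝ E] :
    IsAbsConvexNhdsBase {U : Set E | AbsConvex ℝ U ∧ U ∈ 𝓝 (0 : E)} := by
  refine ⟨fun U hU => hU, fun N hN => ?_⟩
  obtain ⟨U, ⟨hU, hconv⟩, hUN⟩ := (nhds_hasBasis_absConvex ℝ E).mem_iff.1 hN
  exact ⟨U, ⟨hconv, hU⟩, hUN⟩

theorem theorem1p3 {X Y : Type*} [TopologicalSpace X] [T35Space X] [TopologicalSpace Y]
    [T35Space Y] (hX : IsDeltaSpace X) (T : Cp X →L[ℝ] Cp Y) (hT : Function.Surjective T) :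
    ((∃ 𝒰 : Set (Set (Cp X)), IsAbsConvexNhdsBase 𝒰 ∧
        ∀ U ∈ 𝒰, IsClosed U ∧ IsClosed (T '' U)) → IsOpenMap T) ∧
    (IsOpenMap T ↔
      ∃ 𝒰 : Set (Set (Cp X)), IsAbsConvexNhdsBase 𝒰 ∧
        ∀ U ∈ 𝒰, closure (T '' U) ⊆ (2 : ℝ) • (T '' U)) := by
  have hnear : ∀ U : Set (Cp X), AbsConvex ℝ U → U ∈ 𝓝 (0 : Cp X) →
      closure (T '' U) ∈ 𝓝 (0 : Cp Y) := by
    intro U hconv hU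
    obtain ⟨K, hK, hKU⟩ := Cp.exists_coFG_subset_of_mem_nhds_zero hU
    exact closure_image_mem_nhds_zero T hT hconv.2 hU K hKU
  refine ⟨?_, ?_, ?_⟩
  · rintro ⟨𝒰, h𝒰, hclosed⟩
    refine isOpenMap_of_forall_exists_image_mem_nhds_zero T fun N hN => ?_
    obtain ⟨U, hU, hUN⟩ := h𝒰.2 N hN
    refine ⟨U, hUN, ?_⟩
    rw [← (hclosed U hU).2.closure_eq]
    exact hnear U (h𝒰.1 U hU).1 (h𝒰.1 U hU).2
  · intro hopen
    have : LocallyConvexSpace ℝ (Cp X) := .induced (Cp X).subtype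
    refine ⟨_, isAbsConvexNhdsBase_setOf, fun U hU => ?_⟩
    refine (hU.1.2.linear_image T.toLinearMap).closure_subset_two_smul ?_
    simpa using hopen.image_mem_nhds hU.2
  · rintro ⟨𝒰, h𝒰, hclosure⟩
    refine isOpenMap_of_forall_exists_image_mem_nhds_zero T fun N hN => ?_
    obtain ⟨U, hU, hUN⟩ := h𝒰.2 N hN
    refine ⟨U, hUN, ?_⟩
    rw [← set_smul_mem_nhds_zero_iff (two_ne_zero' ℝ)]
    exact Filter.mem_of_superset (hnear U (h𝒰.1 U hU).1 (h𝒰.1 U hU).2) (hclosure U hU)
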